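/- Let $X$ be an $n$-dimensional complex manifold, let $1\le k\le n$, and let $\omega\in H^0(X,\Omega^k_X\otimes\mathcal N)$ be a holomorphic Pfaff system of rank $k$, that is, a nontrivial section, where $\mathcal N$ is a holomorphic line bundle; $\omega$ is given by holomorphic $k$-forms $\omega_\alpha$ on the sets $U_\alpha$ of an open covering with $\omega_\alpha=h_{\alpha\beta}\,\omega_\beta$, where $h_{\alpha\beta}$ is the cocycle of $\mathcal N$. Let $V\subset X$ be a reduced local complete intersection subvariety of pure codimension $k$ which is invariant by $\omega$, i.e. $i^*\omega\equiv 0$ for the inclusion $i$ of (the regular part of) $V$. Let $S$ be an irreducible component of $\mathrm{Sing}(\omega)\cap V$, where $\mathrm{Sing}(\omega)=\{z:\omega(z)=0\}$. Let $x\in S$, and let $P\subset\mathcal O_{V,x}$ be the prime ideal of a local irreducible component of the germ of $S$ at $x$, assumed to be of codimension one in $V$ (that is, $P$ has height one). For $F\in\mathcal O_{V,x}$ let $\mathrm{ord}_S(F)\in\{0,1,2,\dots\}\cup\{\infty\}$ be the length of $(\mathcal O_{V,x})_P/(F)$, and put $\mathrm{ord}_S(\xi/g)=\mathrm{ord}_S(\xi)-\mathrm{ord}_S(g)$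 when both orders are finite. Local data near $x$ are: one of the forms $\omega_\alpha$, holomorphic coordinates $z_1,\dots,z_n$ on an open neighbourhood $W\subset U_\alpha$ of $x$, and holomorphic functions $f_1,\dots,f_k$ on $W$ whose common zero set is $V\cap W$ and which generate the ideal of $V$ at each point of $V\cap W$. An Aleksandrov--Saito decomposition for such data is an identity $$g\,\omega_\alpha=(df_1\wedge\dots\wedge df_k)\,\xi+f_1\eta_1+\dots+f_k\eta_k \quad\text{on } W,$$ where $g,\xi$ are holomorphic functions, $g$ vanishes identically on no irreducible component of $V\cap W$, and $\eta_1,\dots,\eta_k$ are holomorphic $k$-forms. The index $\mathrm{GSV}(\omega,V,S)$ is the integer $\mathrm{ord}_S\big(\tfrac{\xi}{g}|_V\big)$ computed from any such decomposition, for any local data near $x$. Then, for any local data near $x$ (not necessarily those used to compute the index), with $\omega_\alpha=\sum_{|I|=k}a_I\,dZ_I$ and with $\Delta_I$ the $k\times k$ minor of the Jacobian matrix $\mathrm{Jac}(f_1,\dots,f_k)=(\partial f_i/\partial z_j)$ for the columns $I$, and for every multi-index $I=(i_1<\dots<i_k)$: $\mathrm{ord}_S(a_I|_V)$ is finite if and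 only if $\mathrm{ord}_S(\Delta_I|_V)$ is finite, and in that case $$\mathrm{GSV}(\omega,V,S)=\mathrm{ord}_S(a_I|_V)-\mathrm{ord}_S(\Delta_I|_V).$$ -/

import Mathlib

open scoped Manifold ContDiff Topology
open Filter

section GSV

variable {n : ℕ} {X : Type*} [TopologicalSpace X] [ChartedSpace (Fin n → ℂ) X]

/-! ### Holomorphic functions and forms on a complex manifold -/

/-- `F` is holomorphic at (hence near) `x`: in charts it is given by a convergent power series
(the smoothness exponent `ω` means analytic, here over `ℂ`). -/
def HolomorphicAt (n : ℕ) {X : Type*} [TopologicalSpace X] [ChartedSpace (Fin n → ℂ) X]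
    (F : X → ℂ) (x : X) : Prop :=
  ContMDiffAt 𝓘(ℂ, Fin n → ℂ) 𝓘(ℂ, ℂ) ω F x

/-- `F` is holomorphic on the set `W` (used for open `W`). -/
def HolomorphicOn (n : ℕ) {X : Type*} [TopologicalSpace X] [ChartedSpace (Fin n → ℂ) X]
    (F : X → ℂ) (W : Set X) : Prop :=
  ContMDiffOn 𝓘(ℂ, Fin n → ℂ) 𝓘(ℂ, ℂ) ω F W

theorem HolomorphicOn.holomorphicAt {F : X → ℂ} {W : Set X} (h : HolomorphicOn n F W)
    (hW : IsOpen W) {x : X} (hx : x ∈ W) : HolomorphicAt n F x :=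
  h.contMDiffAt (hW.mem_nhds hx)

/-- A (not necessarily holomorphic, or even continuous) field of alternating `k`-covectors on `X`,
that is, a differential form of type `(k, 0)`. -/
abbrev FormField (n k : ℕ) (X : Type*) [TopologicalSpace X] [ChartedSpace (Fin n → ℂ) X] :=
  ∀ z : X, TangentSpace 𝓘(ℂ, Fin n → ℂ) z [⋀^Fin k]→ₗ[ℂ] ℂ

/-- The coordinate vector `∂/∂z_j` at `z` of the chart `e` (used for `z ∈ e.source`). -/
noncomputable def coordVec (e : OpenPartialHomeomorph X (Fin n → ℂ)) (z : X) (j : Fin n) :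
    TangentSpace 𝓘(ℂ, Fin n → ℂ) z :=
  (mfderiv 𝓘(ℂ, Fin n → ℂ) 𝓘(ℂ, Fin n → ℂ) e.symm (e z) (Pi.single j (1 : ℂ)) : Fin n → ℂ)

/-- The coefficient `η(∂/∂z_{J 0}, …, ∂/∂z_{J (k-1)})` of the form `η` in the chart `e`; for
strictly increasing `J` these are the `a_J` in `η = ∑_J a_J dZ_J`. -/
noncomputable def formCoeff {k : ℕ} (e : OpenPartialHomeomorph X (Fin n → ℂ))
    (η : FormField n k X) (J : Fin k → Fin n) (z : X) : ℂ :=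
  η z (fun r => coordVec e z (J r))

/-- `η` is a holomorphic `k`-form on `W`: its coefficients in every holomorphic chart are
holomorphic. -/
def IsHolomorphicForm {k : ℕ} (η : FormField n k X) (W : Set X) : Prop :=
  ∀ e ∈ IsManifold.maximalAtlas 𝓘(ℂ, Fin n → ℂ) ω X, ∀ J : Fin k → Fin n,
    HolomorphicOn n (formCoeff e η J) (W ∩ e.source)

/-- The differential `dF` at `z`, as a linear form on the tangent space. -/
noncomputable def differentialAt (F : X → ℂ) (z : X) :
    TangentSpace 𝓘(ℂ, Fin n → ℂ) z →ₗ[ℂ] ℂ :=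
  (mfderiv 𝓘(ℂ, Fin n → ℂ) 𝓘(ℂ, ℂ) F z).toLinearMap

/-- The form `df_1 ∧ ⋯ ∧ df_k`, with values `(v_1, …, v_k) ↦ det (df_i(v_j))`. -/
noncomputable def wedgeDiff {k : ℕ} (f : Fin k → X → ℂ) : FormField n k X := fun z =>
  (Matrix.detRowAlternating (R := ℂ) (n := Fin k)).compLinearMap
    (LinearMap.pi fun i => differentialAt (n := n) (f i) z)

/-- The partial derivative `∂F/∂z_j` in the chart `e`. -/
noncomputable def partialDeriv (e : OpenPartialHomeomorph X (Fin n → ℂ)) (F : X → ℂ) (j : Fin n)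
    (z : X) : ℂ :=
  fderiv ℂ (F ∘ e.symm) (e z) (Pi.single j (1 : ℂ))

/-- The minor `Δ_I` of the Jacobian matrix of `f_1, …, f_k` in the chart `e` for the columns
`I`. -/
noncomputable def jacobianMinor {k : ℕ} (e : OpenPartialHomeomorph X (Fin n → ℂ))
    (f : Fin k → X → ℂ) (I : Fin k → Fin n) (z : X) : ℂ :=
  (Matrix.of fun i r : Fin k => partialDeriv e (f i) (I r) z).det

theorem HolomorphicOn.partialDeriv [IsManifold 𝓘(ℂ, Fin n → ℂ) ω X]
    {e : OpenPartialHomeomorph X (Fin n → ℂ)}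
    (he : e ∈ IsManifold.maximalAtlas 𝓘(ℂ, Fin n → ℂ) ω X) {F : X → ℂ} {W : Set X}
    (hW : IsOpen W) (hWe : W ⊆ e.source) (hF : HolomorphicOn n F W) (j : Fin n) :
    HolomorphicOn n (_root_.partialDeriv e F j) W := by
  intro x hx
  have hxe := hWe hx
  have hxt : e x ∈ e.target := e.map_source hxe
  have hsymm : ContMDiffAt 𝓘(ℂ, Fin n → ℂ) 𝓘(ℂ, Fin n → ℂ) ω e.symm (e x) :=
    contMDiffAt_symm_of_mem_maximalAtlas he hxt
  have hFx : ContMDiffAt 𝓘(ℂ, Fin n → ℂ) 𝓘(ℂ, ℂ) ω F (e.symm (e x)) := by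
    rw [e.left_inv hxe]
    exact hF.contMDiffAt (hW.mem_nhds hx)
  have hcomp : ContDiffAt ℂ ω (F ∘ e.symm) (e x) :=
    (ContMDiffAt.comp (e x) hFx hsymm).contDiffAt
  have hfd : ContDiffAt ℂ ω (fun w => fderiv ℂ (F ∘ e.symm) w (Pi.single j (1 : ℂ))) (e x) :=
    (hcomp.fderiv_right (m := ω) (by simp)).clm_apply contDiffAt_const
  have he' : ContMDiffAt 𝓘(ℂ, Fin n → ℂ) 𝓘(ℂ, Fin n → ℂ) ω e x :=
    contMDiffAt_of_mem_maximalAtlas he hxe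
  exact (ContMDiffAt.comp x hfd.contMDiffAt he').contMDiffWithinAt

theorem HolomorphicOn.jacobianMinor [IsManifold 𝓘(ℂ, Fin n → ℂ) ω X] {k : ℕ}
    {e : OpenPartialHomeomorph X (Fin n → ℂ)}
    (he : e ∈ IsManifold.maximalAtlas 𝓘(ℂ, Fin n → ℂ) ω X) {f : Fin k → X → ℂ} {W : Set X}
    (hW : IsOpen W) (hWe : W ⊆ e.source) (hf : ∀ i, HolomorphicOn n (f i) W)
    (I : Fin k → Fin n) :
    HolomorphicOn n (_root_.jacobianMinor e f I) W := by
  have hpd : ∀ i j, ContMDiffOn 𝓘(ℂ, Fin n → ℂ) 𝓘(ℂ, ℂ) ω (_root_.partialDeriv e (f i) j) W :=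
    fun i j => (hf i).partialDeriv he hW hWe j
  have hEq : _root_.jacobianMinor e f I = fun z => ∑ σ : Equiv.Perm (Fin k),
      (((Equiv.Perm.sign σ : ℤˣ) : ℤ) : ℂ) *
        ∏ i, _root_.partialDeriv e (f (σ i)) (I i) z := by
    funext z
    simp [_root_.jacobianMinor, Matrix.det_apply']
  rw [hEq]
  exact contMDiffOn_finsetSum fun σ _ =>
    contMDiffOn_const.mul (contMDiffOn_finsetProd fun i _ => hpd _ _)

/-! ### Pfaff systems -/

/-- A holomorphic Pfaff system of rank `k` on `X`: a nontrivial holomorphic section of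
`Ω^k ⊗ N`, given by an open covering `U_α`, holomorphic `k`-forms `ω_α` on `U_α` and a cocycle
`h_{αβ}` of nowhere vanishing holomorphic functions (defining the line bundle `N`) such that
`ω_α = h_{αβ} ω_β`. -/
structure PfaffSystem (n k : ℕ) (X : Type*) [TopologicalSpace X] [ChartedSpace (Fin n → ℂ) X]
    (Λ : Type*) where
  U : Λ → Set X
  isOpen_U : ∀ α, IsOpen (U α)
  cover : ∀ z, ∃ α, z ∈ U α
  form : Λ → FormField n k X
  holomorphic_form : ∀ α, IsHolomorphicForm (form α) (U α)
  h : Λ → Λ → X → ℂ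
  holomorphic_h : ∀ α β, HolomorphicOn n (h α β) (U α ∩ U β)
  h_ne_zero : ∀ α β, ∀ z ∈ U α ∩ U β, h α β z ≠ 0
  h_cocycle : ∀ α β γ, ∀ z ∈ U α ∩ U β ∩ U γ, h α β z * h β γ z = h α γ z
  transition : ∀ α β, ∀ z ∈ U α ∩ U β, form α z = h α β z • form β z
  nontrivial : ∃ α, ∃ z ∈ U α, form α z ≠ 0

/-- The singular set `{z | ω(z) = 0}`. -/
def PfaffSystem.singularSet {k : ℕ} {Λ : Type*} (Ω : PfaffSystem n k X Λ) : Set X :=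
  {z | ∃ α, z ∈ Ω.U α ∧ Ω.form α z = 0}

/-! ### Analytic subsets -/

/-- `Z` is a (closed) analytic subset of `X`. -/
def IsAnalyticSubset (n : ℕ) {X : Type*} [TopologicalSpace X] [ChartedSpace (Fin n → ℂ) X]
    (Z : Set X) : Prop :=
  IsClosed Z ∧ ∀ x ∈ Z, ∃ W : Set X, IsOpen W ∧ x ∈ W ∧ ∃ (N : ℕ) (f : Fin N → X → ℂ),
    (∀ i, HolomorphicOn n (f i) W) ∧ ∀ z ∈ W, z ∈ Z ↔ ∀ i, f i z = 0

/-- `Z` is an irreducible analytic subset of `X`. -/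
def IsIrreducibleAnalytic (n : ℕ) {X : Type*} [TopologicalSpace X] [ChartedSpace (Fin n → ℂ) X]
    (Z : Set X) : Prop :=
  Z.Nonempty ∧ IsAnalyticSubset n Z ∧ ∀ A B : Set X, IsAnalyticSubset n A →
    IsAnalyticSubset n B → Z = A ∪ B → Z = A ∨ Z = B

/-- `S` is an irreducible component of the analytic set `Z`. -/
def IsIrreducibleComponentOf (n : ℕ) {X : Type*} [TopologicalSpace X]
    [ChartedSpace (Fin n → ℂ) X] (S Z : Set X) : Prop :=
  Maximal (fun T : Set X => IsIrreducibleAnalytic n T ∧ T ⊆ Z) S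

/-- `F : X → ℂ^k` is a holomorphic submersion at `y` which defines `V` near `y`; so `V` is a
submanifold of codimension `k` near `y`, with tangent space `ker dF_y` at `y`. -/
def IsSubmersionDefining {k : ℕ} (V : Set X) (F : X → Fin k → ℂ) (y : X) : Prop :=
  ContMDiffAt 𝓘(ℂ, Fin n → ℂ) 𝓘(ℂ, Fin k → ℂ) ω F y ∧
  Function.Surjective (mfderiv 𝓘(ℂ, Fin n → ℂ) 𝓘(ℂ, Fin k → ℂ) F y) ∧
  ∀ᶠ z in 𝓝 y, z ∈ V ↔ F z = 0

/-- `V` has pure codimension `k`: the points at which it is a submanifold of codimension `k` are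
dense in it. -/
def HasPureCodim (n k : ℕ) {X : Type*} [TopologicalSpace X] [ChartedSpace (Fin n → ℂ) X]
    (V : Set X) : Prop :=
  V ⊆ closure {y | y ∈ V ∧ ∃ F : X → Fin k → ℂ, IsSubmersionDefining (n := n) V F y}

/-- `f_1, …, f_k` are local equations of the reduced complete intersection `V` on the open set
`W`: they are holomorphic on `W`, their common zero set is `V ∩ W`, and at every point of `V ∩ W`
they generate the ideal of germs of holomorphic functions vanishing on `V`. -/
structure IsLocalEquations {k : ℕ} (V W : Set X) (f : Fin k → X → ℂ) : Prop where
  isOpen : IsOpen W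
  holomorphic : ∀ i, HolomorphicOn n (f i) W
  mem_iff : ∀ z ∈ W, z ∈ V ↔ ∀ i, f i z = 0
  generates : ∀ y ∈ V ∩ W, ∀ F : X → ℂ, HolomorphicAt n F y → (∀ᶠ z in 𝓝[V] y, F z = 0) →
    ∃ c : Fin k → X → ℂ, (∀ i, HolomorphicAt n (c i) y) ∧ ∀ᶠ z in 𝓝 y, F z = ∑ i, c i z * f i z

/-- `V` is a reduced local complete intersection subvariety of `X` of codimension `k`. -/
structure IsReducedLCI (n k : ℕ) {X : Type*} [TopologicalSpace X] [ChartedSpace (Fin n → ℂ) X]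
    (V : Set X) : Prop where
  isClosed : IsClosed V
  pureCodim : HasPureCodim n k V
  equations : ∀ x ∈ V, ∃ (W : Set X) (f : Fin k → X → ℂ),
    x ∈ W ∧ IsLocalEquations (n := n) V W f

/-- `V` is invariant by the Pfaff system: `i^*ω ≡ 0` for the inclusion `i` of (the regular part
of) `V`. -/
def PfaffSystem.IsInvariant {k : ℕ} {Λ : Type*} (Ω : PfaffSystem n k X Λ) (V : Set X) : Prop :=
  ∀ α, ∀ y ∈ V ∩ Ω.U α, ∀ (l : ℕ) (F : X → Fin l → ℂ), IsSubmersionDefining (n := n) V F y →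
    ∀ v : Fin k → TangentSpace 𝓘(ℂ, Fin n → ℂ) y,
      (∀ r, mfderiv 𝓘(ℂ, Fin n → ℂ) 𝓘(ℂ, Fin l → ℂ) F y (v r) = 0) → Ω.form α y v = 0

/-! ### The local ring of `V` at a point and orders of vanishing -/

/-- The local ring `𝒪_{V,x}` of the reduced analytic set `V`: germs at `x` of functions on `V`
which are restrictions of holomorphic functions on a neighbourhood of `x` in `X`. -/
def holoGerms (n : ℕ) {X : Type*} [TopologicalSpace X] [ChartedSpace (Fin n → ℂ) X]
    (V : Set X) (x : X) : Subring (Germ (𝓝[V] x) ℂ) where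
  carrier := {γ | ∃ F : X → ℂ, HolomorphicAt n F x ∧ γ = (F : Germ (𝓝[V] x) ℂ)}
  mul_mem' := by
    rintro _ _ ⟨F, hF, rfl⟩ ⟨G, hG, rfl⟩
    exact ⟨F * G, ContMDiffAt.mul hF hG, rfl⟩
  one_mem' := ⟨1, contMDiffAt_const, rfl⟩
  add_mem' := by
    rintro _ _ ⟨F, hF, rfl⟩ ⟨G, hG, rfl⟩
    exact ⟨F + G, ContMDiffAt.add hF hG, rfl⟩
  zero_mem' := ⟨0, contMDiffAt_const, rfl⟩
  neg_mem' := by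
    rintro _ ⟨F, hF, rfl⟩
    exact ⟨-F, ContMDiffAt.neg hF, rfl⟩

/-- The restriction `F|_V`, as an element of `𝒪_{V,x}`. -/
def restrictGerm (V : Set X) {x : X} (F : X → ℂ) (hF : HolomorphicAt n F x) :
    holoGerms n V x :=
  ⟨(F : Germ (𝓝[V] x) ℂ), F, hF, rfl⟩

/-- The ideal in `𝒪_{V,x}` of the germs which vanish on the subset `S` of `V`. -/
def vanishingIdeal (n : ℕ) {X : Type*} [TopologicalSpace X] [ChartedSpace (Fin n → ℂ) X]
    (V S : Set X) (x : X) : Ideal (holoGerms n V x) where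
  carrier := {γ | ∃ F : X → ℂ, HolomorphicAt n F x ∧ (γ : Germ (𝓝[V] x) ℂ) = F ∧
    ∀ᶠ z in 𝓝[S] x, F z = 0}
  add_mem' := by
    rintro ⟨_, _⟩ ⟨_, _⟩ ⟨F, hF, rfl, h0⟩ ⟨G, hG, rfl, h1⟩
    exact ⟨F + G, ContMDiffAt.add hF hG, rfl, by
      filter_upwards [h0, h1] with z h2 h3; simp [h2, h3]⟩
  zero_mem' := ⟨0, contMDiffAt_const, rfl, by simp⟩
  smul_mem' := by
    rintro ⟨_, G, hG, rfl⟩ ⟨_, _⟩ ⟨F, hF, rfl, h0⟩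
    exact ⟨G * F, ContMDiffAt.mul hG hF, rfl, by
      filter_upwards [h0] with z h2; simp [h2]⟩

/-- A local branch of codimension one of `S` in `V`: a point `pt ∈ S` and a local irreducible
component of the germ of `S` at `pt`, given by its prime ideal in `𝒪_{V,pt}`, of codimension one
in `V`. -/
structure DivisorBranch (n : ℕ) {X : Type*} [TopologicalSpace X] [ChartedSpace (Fin n → ℂ) X]
    (V S : Set X) where
  pt : X
  pt_mem : pt ∈ S
  prime : Ideal (holoGerms n V pt)
  mem_minimalPrimes : prime ∈ (vanishingIdeal n V S pt).minimalPrimes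
  height_eq_one : prime.height = 1

instance DivisorBranch.isPrime {V S : Set X} (b : DivisorBranch n V S) : b.prime.IsPrime :=
  b.mem_minimalPrimes.1.1

/-- The local ring `𝒪_{V,S}` of `V` along the branch. -/
abbrev DivisorBranch.localRing {V S : Set X} (b : DivisorBranch n V S) : Type _ :=
  Localization.AtPrime b.prime

/-- The order of vanishing `ord_S (F|_V)` along the branch: the length of `𝒪_{V,S} / (F)`. It is
`⊤` exactly when the length is infinite. -/
noncomputable def DivisorBranch.ord {V S : Set X} (b : DivisorBranch n V S) (F : X → ℂ)
    (hF : HolomorphicAt n F b.pt) : ℕ∞ :=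
  Ring.ord b.localRing (algebraMap (holoGerms n V b.pt) b.localRing (restrictGerm V F hF))

/-! ### Local presentations, decompositions and the index -/

/-- Local data near the point `x`: a member `α` of the covering (that is, a local representation
`ω_α` of the Pfaff system), holomorphic coordinates `e`, an open set `W ∋ x` in the domain of both,
and local equations `f_1, …, f_k` of `V` on `W`. -/
structure LocalPresentation {k : ℕ} {Λ : Type*} (Ω : PfaffSystem n k X Λ) (V : Set X) (x : X)
    where
  α : Λ
  e : OpenPartialHomeomorph X (Fin n → ℂ)
  chart_mem : e ∈ IsManifold.maximalAtlas 𝓘(ℂ, Fin n → ℂ) ω X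
  W : Set X
  mem : x ∈ W
  subset_U : W ⊆ Ω.U α
  subset_source : W ⊆ e.source
  f : Fin k → X → ℂ
  equations : IsLocalEquations (n := n) V W f

namespace LocalPresentation

variable {k : ℕ} {Λ : Type*} {Ω : PfaffSystem n k X Λ} {V : Set X} {x : X}

/-- The coefficient `a_I` in `ω_α = ∑_I a_I dZ_I`. -/
noncomputable def coeff (D : LocalPresentation Ω V x) (I : Fin k ↪o Fin n) : X → ℂ :=
  formCoeff D.e (Ω.form D.α) I

/-- The minor `Δ_I` of `Jac(f_1, …, f_k)`. -/
noncomputable def minor (D : LocalPresentation Ω V x) (I : Fin k ↪o Fin n) : X → ℂ :=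
  jacobianMinor D.e D.f I

theorem holomorphicAt_coeff (D : LocalPresentation Ω V x) (I : Fin k ↪o Fin n) :
    HolomorphicAt n (D.coeff I) x :=
  HolomorphicOn.holomorphicAt (Ω.holomorphic_form D.α D.e D.chart_mem I)
    ((Ω.isOpen_U D.α).inter D.e.open_source) ⟨D.subset_U D.mem, D.subset_source D.mem⟩

theorem holomorphicAt_minor [IsManifold 𝓘(ℂ, Fin n → ℂ) ω X] (D : LocalPresentation Ω V x)
    (I : Fin k ↪o Fin n) : HolomorphicAt n (D.minor I) x :=
  (HolomorphicOn.jacobianMinor D.chart_mem D.equations.isOpen D.subset_source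
    D.equations.holomorphic I).holomorphicAt D.equations.isOpen D.mem

/-- `g ω_α = (df_1 ∧ ⋯ ∧ df_k) ξ + ∑ f_i η_i` is an Aleksandrov-Saito decomposition on `W`: `g`, `ξ`
are holomorphic functions, the `η_i` are holomorphic `k`-forms, and `g` does not vanish identically
on any irreducible component of `V ∩ W`, equivalently on any nonempty open subset of `V ∩ W`. -/
structure IsDecomposition (D : LocalPresentation Ω V x) (g ξ : X → ℂ)
    (η : Fin k → FormField n k X) : Prop where
  holomorphic_g : HolomorphicOn n g D.W
  holomorphic_ξ : HolomorphicOn n ξ D.W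
  holomorphic_η : ∀ i, IsHolomorphicForm (η i) D.W
  dense : V ∩ D.W ⊆ closure {z | z ∈ V ∩ D.W ∧ g z ≠ 0}
  eq : ∀ z ∈ D.W, g z • Ω.form D.α z =
    ξ z • wedgeDiff (n := n) D.f z + ∑ i, D.f i z • η i z

end LocalPresentation

/-- `m` is the index `GSV(ω, V, S)`, computed at a branch of `S`: for some local representation of
the Pfaff system, local equations of `V` and Aleksandrov-Saito decomposition near the point of the
branch, `m = ord_S (ξ/g |_V) = ord_S (ξ|_V) - ord_S (g|_V)`. -/
def PfaffSystem.IsGSVIndex {k : ℕ} {Λ : Type*} (Ω : PfaffSystem n k X Λ) (V S : Set X)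
    (b : DivisorBranch n V S) (m : ℤ) : Prop :=
  ∃ (D : LocalPresentation Ω V b.pt) (g ξ : X → ℂ) (η : Fin k → FormField n k X)
    (h : D.IsDecomposition g ξ η) (p q : ℕ),
    b.ord ξ (h.holomorphic_ξ.holomorphicAt D.equations.isOpen D.mem) = p ∧
    b.ord g (h.holomorphic_g.holomorphicAt D.equations.isOpen D.mem) = q ∧
    m = (p : ℤ) - (q : ℤ)

end GSV

/-! On `V` all `f_i` vanish, so evaluating an Aleksandrov-Saito decomposition on coordinate vectors
gives `g a_I = ξ Δ_I` there. The local ring of `V` along the branch is reduced of dimension one,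
hence `g` and `ξ`, having finite order, are not zero divisors, and the order is additive on both
products: `ord a_I + ord g = ord Δ_I + ord ξ` in `ℕ∞`. Since `ord g` and `ord ξ` are finite, this
one equality yields both the equivalence and the formula.

It remains to compare two sets of local data. Changing `ω_α` multiplies `a_I` by a cocycle function,
a unit. If `f = C f'` and `f' = C' f`, then `Δ_I` is multiplied on `V` by `det C`, and this must be
shown to be a unit of the local ring. Differentiating along `V` gives `J = C J'` and `J' = C' J`, so
`C C' J = J`. At a regular point the submersion defining `V` lies in the ideal of the `f_i`, which
forces `J` to have rank `k`; there `C C' = 1`. By density of regular points and continuity, `det C *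
det C' = 1` on all of `V` near the point (`IsReducedLCI.transition_mul_eq_one`). -/

/-! ### Orders of vanishing along a branch. -/

/-- In a reduced local ring of nonzero Krull dimension, an element of finite order of vanishing is
not a zero divisor. -/
theorem Ring.mem_nonZeroDivisors_of_ord_ne_top {R : Type*} [CommRing R] [IsLocalRing R]
    [IsReduced R] (hdim : ringKrullDim R ≠ 0) {x : R} (hx : Ring.ord R x ≠ ⊤) :
    x ∈ nonZeroDivisors R := by
  rw [mem_nonZeroDivisors_iff_right]
  intro y hyx
  by_contra hy
  -- In a reduced ring the minimal primes intersect in zero.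
  obtain ⟨p, hp, hyp⟩ : ∃ p ∈ minimalPrimes R, y ∉ p := by
    have h0 : y ∉ (⊥ : Ideal R).radical := by
      rw [show (⊥ : Ideal R).radical = ⊥ from nilradical_eq_zero R]
      simpa using hy
    simpa [← Ideal.sInf_minimalPrimes, minimalPrimes] using h0
  have hpp : p.IsPrime := hp.1.1
  have hxp : x ∈ p :=
    (hpp.mem_or_mem (show y * x ∈ p by rw [hyx]; exact p.zero_mem)).resolve_left hyp
  rw [Ring.ord, Module.length_ne_top_iff, isFiniteLength_iff_isNoetherian_isArtinian] at hx
  have hle : Ideal.span {x} ≤ p := (Ideal.span_singleton_le_iff_mem p).2 hxp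
  -- As a quotient of `R ⧸ (x)`, the domain `R ⧸ p` is Artinian, hence a field. So the minimal prime
  -- `p` is maximal, which forces dimension zero.
  have hart : IsArtinian R (R ⧸ p) := by
    have := hx.2
    exact isArtinian_of_surjective (R ⧸ Ideal.span {x}) (Submodule.factor hle)
      (Submodule.factor_surjective hle)
  have hartR : IsArtinianRing (R ⧸ p) :=
    isArtinian_of_tower R hart
  have hmax : p.IsMaximal :=
    Ideal.Quotient.maximal_of_isField _ (IsArtinianRing.isField_of_isDomain _)
  have hpm : p = IsLocalRing.maximalIdeal R := IsLocalRing.eq_maximalIdeal hmax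
  apply hdim
  rw [← IsLocalRing.maximalIdeal_height_eq_ringKrullDim, ← hpm,
    Ideal.height_eq_zero_iff.2 hp]
  rfl

section

variable {n : ℕ} {X : Type*} [TopologicalSpace X] [ChartedSpace (Fin n → ℂ) X]

/-- The elements are germs of `ℂ`-valued functions on `V`, so a nilpotent one vanishes pointwise. -/
theorem isReduced_holoGerms (V : Set X) (x : X) : IsReduced (holoGerms n V x) := by
  refine ⟨?_⟩
  rintro ⟨_, F, hF, rfl⟩ ⟨m, hm⟩
  have h1 : ((F ^ m : X → ℂ) : Germ (𝓝[V] x) ℂ) = (0 : X → ℂ) := congrArg Subtype.val hm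
  refine Subtype.ext (Germ.coe_eq.2 ?_)
  filter_upwards [Germ.coe_eq.1 h1] with z hz
  exact eq_zero_of_pow_eq_zero hz

theorem isReduced_localRing {V S : Set X} (b : DivisorBranch n V S) :
    IsReduced b.localRing :=
  isReduced_localizationPreserves b.prime.primeCompl _ (isReduced_holoGerms V b.pt)

/-- Height one of the branch prime makes the dimension of the localization one, in particular
nonzero. -/
theorem DivisorBranch.mem_nonZeroDivisors_of_ord {V S : Set X} (b : DivisorBranch n V S)
    {x : b.localRing} {p : ℕ} (hx : Ring.ord b.localRing x = p) :
    x ∈ nonZeroDivisors b.localRing := by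
  have := isReduced_localRing b
  refine Ring.mem_nonZeroDivisors_of_ord_ne_top ?_ (hx ▸ ENat.natCast_ne_top p)
  rw [IsLocalization.AtPrime.ringKrullDim_eq_height b.prime b.localRing, b.height_eq_one]
  exact one_ne_zero

/-- Functions with `g a = ξ d` on `V` have additive orders along a branch. -/
theorem DivisorBranch.ord_add_ord {V S : Set X} (b : DivisorBranch n V S) {g a ξ d : X → ℂ}
    (hg : HolomorphicAt n g b.pt) (ha : HolomorphicAt n a b.pt) (hξ : HolomorphicAt n ξ b.pt)
    (hd : HolomorphicAt n d b.pt) (h : ∀ᶠ z in 𝓝[V] b.pt, g z * a z = ξ z * d z) {p q : ℕ}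
    (hp : b.ord ξ hξ = p) (hq : b.ord g hg = q) : b.ord a ha + q = b.ord d hd + p := by
  have hmul : restrictGerm V g hg * restrictGerm V a ha =
      restrictGerm V ξ hξ * restrictGerm V d hd :=
    Subtype.ext (Germ.coe_eq.2 h)
  have h1 := congrArg (Ring.ord b.localRing)
    (congrArg (algebraMap (holoGerms n V b.pt) b.localRing) hmul)
  -- Additivity needs only one factor to be a non zero divisor, so `a` and `d` may have infinite
  -- order.
  rw [map_mul, map_mul, Ring.ord_mul' _ (b.mem_nonZeroDivisors_of_ord hq),
    Ring.ord_mul' _ (b.mem_nonZeroDivisors_of_ord hp)] at h1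
  rw [← hp, ← hq, add_comm, add_comm (b.ord d hd)]
  exact h1

/-- Multiplication by a function invertible on `V` does not change the order along a branch. -/
theorem DivisorBranch.ord_eq_of_unit {V S : Set X} (b : DivisorBranch n V S) {u v a d : X → ℂ}
    (hu : HolomorphicAt n u b.pt) (hv : HolomorphicAt n v b.pt)
    (ha : HolomorphicAt n a b.pt) (hd : HolomorphicAt n d b.pt)
    (huv : ∀ᶠ z in 𝓝[V] b.pt, u z * v z = 1) (h : ∀ᶠ z in 𝓝[V] b.pt, a z = u z * d z) :
    b.ord a ha = b.ord d hd := by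
  have hmul : restrictGerm V a ha = restrictGerm V u hu * restrictGerm V d hd :=
    Subtype.ext (Germ.coe_eq.2 h)
  have hunit : IsUnit (restrictGerm V u hu) :=
    IsUnit.of_mul_eq_one (restrictGerm V v hv) (Subtype.ext (Germ.coe_eq.2 huv))
  rw [DivisorBranch.ord, hmul, map_mul, Ring.ord_mul_of_isUnit_left (hunit.map _)]
  rfl

end

/-! ### Jacobian matrices, and regular points of `V`. -/

section

variable {n : ℕ} {X : Type*} [TopologicalSpace X] [ChartedSpace (Fin n → ℂ) X]

theorem HolomorphicAt.eventually [IsManifold 𝓘(ℂ, Fin n → ℂ) ω X] {F : X → ℂ} {x : X}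
    (h : HolomorphicAt n F x) : ∀ᶠ z in 𝓝 x, HolomorphicAt n F z :=
  (contMDiffAt_iff_contMDiffAt_nhds (by simp)).1 h

theorem HolomorphicAt.det {k : ℕ} {c : Fin k → Fin k → X → ℂ} {x : X}
    (hc : ∀ i j, HolomorphicAt n (c i j) x) :
    HolomorphicAt n (fun z => (Matrix.of fun i j => c i j z).det) x := by
  have hEq : (fun z => (Matrix.of fun i j => c i j z).det) =
      fun z => ∑ σ : Equiv.Perm (Fin k), (((Equiv.Perm.sign σ : ℤˣ) : ℤ) : ℂ) *
        ∏ i, c (σ i) i z := by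
    funext z
    simp [Matrix.det_apply']
  rw [hEq]
  exact contMDiffAt_finsetSum fun σ _ =>
    contMDiffAt_const.mul (contMDiffAt_finsetProd fun i _ => hc _ _)

theorem HolomorphicAt.differentiableAt_comp_symm {e : OpenPartialHomeomorph X (Fin n → ℂ)}
    (he : e ∈ IsManifold.maximalAtlas 𝓘(ℂ, Fin n → ℂ) ω X) {F : X → ℂ} {z : X}
    (hz : z ∈ e.source) (hF : HolomorphicAt n F z) :
    DifferentiableAt ℂ (F ∘ e.symm) (e z) := by
  have hsymm : ContMDiffAt 𝓘(ℂ, Fin n → ℂ) 𝓘(ℂ, Fin n → ℂ) ω e.symm (e z) :=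
    contMDiffAt_symm_of_mem_maximalAtlas he (e.map_source hz)
  have hFx : ContMDiffAt 𝓘(ℂ, Fin n → ℂ) 𝓘(ℂ, ℂ) ω F (e.symm (e z)) := by
    rwa [e.left_inv hz]
  exact (ContMDiffAt.comp (e z) hFx hsymm).contDiffAt.differentiableAt (by simp)

/-- On the common zero set of the `f i`, the partial derivatives of a linear combination of them
are the linear combinations of their partial derivatives. -/
theorem partialDeriv_eq_sum {e : OpenPartialHomeomorph X (Fin n → ℂ)}
    (he : e ∈ IsManifold.maximalAtlas 𝓘(ℂ, Fin n → ℂ) ω X) {k : ℕ} {F : X → ℂ}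
    {c f : Fin k → X → ℂ} {z : X} (hz : z ∈ e.source) (hc : ∀ i, HolomorphicAt n (c i) z)
    (hf : ∀ i, HolomorphicAt n (f i) z) (h0 : ∀ i, f i z = 0)
    (hF : ∀ᶠ y in 𝓝 z, F y = ∑ i, c i y * f i y) (j : Fin n) :
    partialDeriv e F j z = ∑ i, c i z * partialDeriv e (f i) j z := by
  have hcont : Tendsto e.symm (𝓝 (e z)) (𝓝 z) := by
    simpa [e.left_inv hz] using (e.continuousAt_symm (e.map_source hz)).tendsto
  have hEq : F ∘ e.symm =ᶠ[𝓝 (e z)]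
      fun w => ∑ i, (c i ∘ e.symm) w * (f i ∘ e.symm) w := hcont.eventually hF
  have hdc i := (hc i).differentiableAt_comp_symm he hz
  have hdf i := (hf i).differentiableAt_comp_symm he hz
  rw [partialDeriv, hEq.fderiv_eq, fderiv_fun_sum fun i _ => (hdc i).fun_mul (hdf i)]
  simp only [sum_apply]
  refine Finset.sum_congr rfl fun i _ => ?_
  -- The Leibniz terms containing derivatives of `c i` carry the factor `f i z = 0`.
  rw [fderiv_fun_mul (hdc i) (hdf i)]
  simp [e.left_inv hz, h0, partialDeriv]

theorem differentialAt_coordVec [IsManifold 𝓘(ℂ, Fin n → ℂ) ω X]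
    {e : OpenPartialHomeomorph X (Fin n → ℂ)}
    (he : e ∈ IsManifold.maximalAtlas 𝓘(ℂ, Fin n → ℂ) ω X) {F : X → ℂ} {z : X}
    (hz : z ∈ e.source) (hF : HolomorphicAt n F z) (j : Fin n) :
    differentialAt (n := n) F z (coordVec e z j) = partialDeriv e F j z := by
  have hsymm : MDifferentiableAt 𝓘(ℂ, Fin n → ℂ) 𝓘(ℂ, Fin n → ℂ) e.symm (e z) :=
    (contMDiffAt_symm_of_mem_maximalAtlas he (e.map_source hz)).mdifferentiableAt (by simp)
  have hFz : MDifferentiableAt 𝓘(ℂ, Fin n → ℂ) 𝓘(ℂ, ℂ) F (e.symm (e z)) := by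
    rw [e.left_inv hz]
    exact ContMDiffAt.mdifferentiableAt hF (by simp)
  have h := mfderiv_comp (e z) hFz hsymm
  rw [mfderiv_eq_fderiv] at h
  rw [partialDeriv, h]
  rw [e.left_inv hz]
  rfl

/-- The coefficients of `df_1 ∧ ⋯ ∧ df_k` are the minors of the Jacobian matrix. -/
theorem wedgeDiff_coordVec [IsManifold 𝓘(ℂ, Fin n → ℂ) ω X]
    {e : OpenPartialHomeomorph X (Fin n → ℂ)}
    (he : e ∈ IsManifold.maximalAtlas 𝓘(ℂ, Fin n → ℂ) ω X) {k : ℕ} {f : Fin k → X → ℂ} {z : X}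
    (hz : z ∈ e.source) (hf : ∀ i, HolomorphicAt n (f i) z) (I : Fin k → Fin n) :
    formCoeff e (wedgeDiff (n := n) f) I z = jacobianMinor e f I z := by
  rw [jacobianMinor, ← Matrix.det_transpose]
  change Matrix.det _ = _
  congr 1
  ext r i
  exact differentialAt_coordVec he hz (hf i) (I r)

/-- The Jacobian matrix of a submersion has a right inverse. -/
theorem IsSubmersionDefining.exists_rightInverse [IsManifold 𝓘(ℂ, Fin n → ℂ) ω X]
    {e : OpenPartialHomeomorph X (Fin n → ℂ)}
    (he : e ∈ IsManifold.maximalAtlas 𝓘(ℂ, Fin n → ℂ) ω X) {k : ℕ} {V : Set X}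
    {F : X → Fin k → ℂ} {y : X} (hy : y ∈ e.source) (hF : IsSubmersionDefining (n := n) V F y) :
    ∃ B : Matrix (Fin n) (Fin k) ℂ,
      (Matrix.of fun i j => partialDeriv e (fun z => F z i) j y) * B = 1 := by
  have hsymm : MDifferentiableAt 𝓘(ℂ, Fin n → ℂ) 𝓘(ℂ, Fin n → ℂ) e.symm (e y) :=
    (contMDiffAt_symm_of_mem_maximalAtlas he (e.map_source hy)).mdifferentiableAt (by simp)
  have hFy : MDifferentiableAt 𝓘(ℂ, Fin n → ℂ) 𝓘(ℂ, Fin k → ℂ) F (e.symm (e y)) := by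
    rw [e.left_inv hy]
    exact hF.1.mdifferentiableAt (by simp)
  have hG : MDifferentiableAt 𝓘(ℂ, Fin n → ℂ) 𝓘(ℂ, Fin k → ℂ) (F ∘ e.symm) (e y) :=
    hFy.comp (e y) hsymm
  have hGd : DifferentiableAt ℂ (F ∘ e.symm) (e y) := hG.differentiableAt
  have hey : MDifferentiableAt 𝓘(ℂ, Fin n → ℂ) 𝓘(ℂ, Fin n → ℂ) e y :=
    (contMDiffAt_of_mem_maximalAtlas he hy).mdifferentiableAt (by simp)
  -- Through this factorization, surjectivity of the derivative of `F` passes to that of `F ∘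
  -- e.symm`; preimages of the basis vectors are the columns of `B`.
  have hFG : F =ᶠ[𝓝 y] (F ∘ e.symm) ∘ e := by
    filter_upwards [e.open_source.mem_nhds hy] with z hz
    simp [e.left_inv hz]
  have hcomp := mfderiv_comp y hG hey
  have hsurj : ∀ w : Fin k → ℂ, ∃ v : Fin n → ℂ, fderiv ℂ (F ∘ e.symm) (e y) v = w := by
    intro w
    obtain ⟨v, hv⟩ := hF.2.1 w
    rw [hFG.mfderiv_eq, hcomp, mfderiv_eq_fderiv] at hv
    exact ⟨_, hv⟩
  choose v hv using fun i : Fin k => hsurj (Pi.single i 1)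
  refine ⟨Matrix.of fun j i => v i j, ?_⟩
  ext i l
  have h1 : fderiv ℂ (F ∘ e.symm) (e y) (v l) i = (1 : Matrix (Fin k) (Fin k) ℂ) i l := by
    rw [hv l, Matrix.one_apply, Pi.single_apply]
  have h2 (j : Fin n) : partialDeriv e (fun z => F z i) j y =
      fderiv ℂ (F ∘ e.symm) (e y) (Pi.single j 1) i :=
    congrArg (· (Pi.single j 1)) (hasFDerivAt_pi'.1 hGd.hasFDerivAt i).fderiv
  rw [← h1, Matrix.mul_apply]
  conv_rhs => rw [pi_eq_sum_univ' (v l)]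
  simp [h2, mul_comm]

/-- If two systems of local equations `f`, `f'` of `V` are related by `f = C f'`, `f' = C' f`, then
`C C' = 1` at the regular points of `V`. -/
theorem IsSubmersionDefining.transition_mul_eq_one [IsManifold 𝓘(ℂ, Fin n → ℂ) ω X]
    {e : OpenPartialHomeomorph X (Fin n → ℂ)}
    (he : e ∈ IsManifold.maximalAtlas 𝓘(ℂ, Fin n → ℂ) ω X) {k : ℕ} {V W W' : Set X}
    {f f' : Fin k → X → ℂ} (hf : IsLocalEquations (n := n) V W f)
    (hf' : IsLocalEquations (n := n) V W' f') {c c' : Fin k → Fin k → X → ℂ} {y : X}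
    (hy : y ∈ e.source) (hyV : y ∈ V) (hyW : y ∈ W) (hyW' : y ∈ W')
    (hc : ∀ i j, HolomorphicAt n (c i j) y) (hc' : ∀ i j, HolomorphicAt n (c' i j) y)
    (hfc : ∀ i, ∀ᶠ z in 𝓝 y, f i z = ∑ j, c i j z * f' j z)
    (hfc' : ∀ i, ∀ᶠ z in 𝓝 y, f' i z = ∑ j, c' i j z * f j z)
    {F : X → Fin k → ℂ} (hF : IsSubmersionDefining (n := n) V F y) :
    (Matrix.of fun i j => c i j y) * (Matrix.of fun i j => c' i j y) = 1 := by
  have hholo i : HolomorphicAt n (f i) y := (hf.holomorphic i).holomorphicAt hf.isOpen hyW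
  have hholo' i : HolomorphicAt n (f' i) y := (hf'.holomorphic i).holomorphicAt hf'.isOpen hyW'
  have h0 := (hf.mem_iff y hyW).1 hyV
  have h0' := (hf'.mem_iff y hyW').1 hyV
  have hFi (i : Fin k) : HolomorphicAt n (fun z => F z i) y := (contMDiffAt_pi_space.1 hF.1) i
  have hFV (i : Fin k) : ∀ᶠ z in 𝓝[V] y, F z i = 0 := by
    filter_upwards [nhdsWithin_le_nhds hF.2.2, self_mem_nhdsWithin] with z hz hzV
    rw [hz.1 hzV]
    rfl
  -- The components of `F` vanish on `V`, so `F = A f` near `y`; hence `A J` is the Jacobian matrix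
  -- of `F`.
  choose a ha haF using fun i => hf.generates y ⟨hyV, hyW⟩ _ (hFi i) (hFV i)
  obtain ⟨B, hB⟩ := hF.exists_rightInverse he hy
  set J : Matrix (Fin k) (Fin n) ℂ := Matrix.of fun i j => partialDeriv e (f i) j y
  set J' : Matrix (Fin k) (Fin n) ℂ := Matrix.of fun i j => partialDeriv e (f' i) j y
  set C : Matrix (Fin k) (Fin k) ℂ := Matrix.of fun i j => c i j y
  set C' : Matrix (Fin k) (Fin k) ℂ := Matrix.of fun i j => c' i j y
  set A : Matrix (Fin k) (Fin k) ℂ := Matrix.of fun i j => a i j y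
  have hJ : J = C * J' := by
    ext i j
    exact partialDeriv_eq_sum he hy (hc i) hholo' h0' (hfc i) j
  have hJ' : J' = C' * J := by
    ext i j
    exact partialDeriv_eq_sum he hy (hc' i) hholo h0 (hfc' i) j
  have hA : A * (J * B) = 1 := by
    rw [← hB, ← Matrix.mul_assoc]
    congr 1
    ext i j
    exact (partialDeriv_eq_sum he hy (ha i) hholo h0 (haF i) j).symm
  -- `A` and `J * B` are square, so the left inverse is also a right inverse and `J` can be
  -- cancelled from `C C' J = J`.
  have hJB : J * B * A = 1 := mul_eq_one_comm.1 hA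
  have hCC : C * C' * J = J := by rw [Matrix.mul_assoc, ← hJ', ← hJ]
  rw [← mul_one (C * C'), ← hJB, ← Matrix.mul_assoc, ← Matrix.mul_assoc, hCC]

end

/-! ### Independence of the local data. -/

section

variable {n : ℕ} {X : Type*} [TopologicalSpace X] [ChartedSpace (Fin n → ℂ) X]

/-- The matrices relating two systems of local equations of a reduced local complete intersection
are inverse to each other on `V`. -/
theorem IsReducedLCI.transition_mul_eq_one [IsManifold 𝓘(ℂ, Fin n → ℂ) ω X]
    {e : OpenPartialHomeomorph X (Fin n → ℂ)}
    (he : e ∈ IsManifold.maximalAtlas 𝓘(ℂ, Fin n → ℂ) ω X) {k : ℕ} {V W W' : Set X}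
    (hV : IsReducedLCI n k V) {f f' : Fin k → X → ℂ} (hf : IsLocalEquations (n := n) V W f)
    (hf' : IsLocalEquations (n := n) V W' f') {c c' : Fin k → Fin k → X → ℂ} {x : X}
    (hx : x ∈ e.source) (hxW : x ∈ W) (hxW' : x ∈ W')
    (hc : ∀ i j, HolomorphicAt n (c i j) x) (hc' : ∀ i j, HolomorphicAt n (c' i j) x)
    (hfc : ∀ i, ∀ᶠ z in 𝓝 x, f i z = ∑ j, c i j z * f' j z)
    (hfc' : ∀ i, ∀ᶠ z in 𝓝 x, f' i z = ∑ j, c' i j z * f j z) :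
    ∀ᶠ z in 𝓝[V] x,
      (Matrix.of fun i j => c i j z).det * (Matrix.of fun i j => c' i j z).det = 1 := by
  have hev : ∀ᶠ z in 𝓝 x, z ∈ e.source ∧ z ∈ W ∧ z ∈ W' ∧ (∀ i j, HolomorphicAt n (c i j) z) ∧
      (∀ i j, HolomorphicAt n (c' i j) z) ∧
      (∀ i, ∀ᶠ y in 𝓝 z, f i y = ∑ j, c i j y * f' j y) ∧
      ∀ i, ∀ᶠ y in 𝓝 z, f' i y = ∑ j, c' i j y * f j y := by
    filter_upwards [e.open_source.mem_nhds hx, hf.isOpen.mem_nhds hxW, hf'.isOpen.mem_nhds hxW',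
      eventually_all.2 fun i => eventually_all.2 fun j => (hc i j).eventually,
      eventually_all.2 fun i => eventually_all.2 fun j => (hc' i j).eventually,
      eventually_all.2 fun i => (hfc i).eventually_nhds,
      eventually_all.2 fun i => (hfc' i).eventually_nhds] with z h1 h2 h3 h4 h5 h6 h7
    exact ⟨h1, h2, h3, h4, h5, h6, h7⟩
  filter_upwards [nhdsWithin_le_nhds hev.eventually_nhds, self_mem_nhdsWithin] with z hz hzV
  obtain ⟨-, -, -, hcz, hcz', -, -⟩ := hz.self_of_nhds
  have hcont : ContinuousAt (fun y => (Matrix.of fun i j => c i j y).det *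
      (Matrix.of fun i j => c' i j y).det) z :=
    (ContMDiffAt.continuousAt (HolomorphicAt.det hcz)).mul
      (ContMDiffAt.continuousAt (HolomorphicAt.det hcz'))
  -- If the product differed from 1 at `z`, it would by continuity differ from 1 at a nearby regular
  -- point of `V`.
  have hfreq := (mem_closure_iff_frequently.1 (hV.pureCodim hzV)).and_eventually hz
  by_contra hne
  obtain ⟨y, ⟨⟨hyV, F, hF⟩, hy, hyW, hyW', hcy, hcy', hfy, hfy'⟩, hney⟩ :=
    (hfreq.and_eventually (hcont.eventually_ne hne)).exists
  have h1 := hF.transition_mul_eq_one he hf hf' hy hyV hyW hyW' hcy hcy' hfy hfy'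
  apply hney
  rw [← Matrix.det_mul, h1, Matrix.det_one]

/-- Jacobian minors of two systems of local equations differ, on `V`, by the determinant of the
transition matrix. -/
theorem jacobianMinor_eq_det_mul {e : OpenPartialHomeomorph X (Fin n → ℂ)}
    (he : e ∈ IsManifold.maximalAtlas 𝓘(ℂ, Fin n → ℂ) ω X) {k : ℕ} {f f' : Fin k → X → ℂ}
    {c : Fin k → Fin k → X → ℂ} {z : X} (hz : z ∈ e.source)
    (hc : ∀ i j, HolomorphicAt n (c i j) z) (hf' : ∀ i, HolomorphicAt n (f' i) z)
    (h0 : ∀ i, f' i z = 0) (hfc : ∀ i, ∀ᶠ y in 𝓝 z, f i y = ∑ j, c i j y * f' j y)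
    (I : Fin k → Fin n) :
    jacobianMinor e f I z =
      (Matrix.of fun i j => c i j z).det * jacobianMinor e f' I z := by
  rw [jacobianMinor, jacobianMinor, ← Matrix.det_mul]
  congr 1
  ext i r
  exact partialDeriv_eq_sum he hz (hc i) hf' h0 (hfc i) (I r)

/-- Each `f i` vanishes on `V`, and the `f'` generate the ideal of `V` at `x`. -/
theorem IsLocalEquations.exists_transition {k : ℕ} {V W W' : Set X} {f f' : Fin k → X → ℂ}
    (hf : IsLocalEquations (n := n) V W f) (hf' : IsLocalEquations (n := n) V W' f') {x : X}
    (hxV : x ∈ V) (hxW : x ∈ W) (hxW' : x ∈ W') :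
    ∃ c : Fin k → Fin k → X → ℂ, (∀ i j, HolomorphicAt n (c i j) x) ∧
      ∀ i, ∀ᶠ z in 𝓝 x, f i z = ∑ j, c i j z * f' j z := by
  have h0 (i : Fin k) : ∀ᶠ z in 𝓝[V] x, f i z = 0 := by
    filter_upwards [nhdsWithin_le_nhds (hf.isOpen.mem_nhds hxW), self_mem_nhdsWithin] with z hz hzV
    exact (hf.mem_iff z hz).1 hzV i
  choose c hc hfc using fun i => hf'.generates x ⟨hxV, hxW'⟩ _
    ((hf.holomorphic i).holomorphicAt hf.isOpen hxW) (h0 i)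
  exact ⟨c, hc, hfc⟩

/-- On `V`, an Aleksandrov-Saito decomposition relates, in any chart, the coefficients of the form
to the Jacobian minors. -/
theorem LocalPresentation.IsDecomposition.coeff_eq [IsManifold 𝓘(ℂ, Fin n → ℂ) ω X] {k : ℕ}
    {Λ : Type*} {Ω : PfaffSystem n k X Λ} {V : Set X} {x : X} {D : LocalPresentation Ω V x}
    {g ξ : X → ℂ} {η : Fin k → FormField n k X} (h : D.IsDecomposition g ξ η)
    {e : OpenPartialHomeomorph X (Fin n → ℂ)}
    (he : e ∈ IsManifold.maximalAtlas 𝓘(ℂ, Fin n → ℂ) ω X) {z : X} (hz : z ∈ e.source)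
    (hzV : z ∈ V) (hzW : z ∈ D.W) (I : Fin k → Fin n) :
    g z * formCoeff e (Ω.form D.α) I z = ξ z * jacobianMinor e D.f I z := by
  have h1 := congrArg (fun θ => θ fun r => coordVec e z (I r)) (h.eq z hzW)
  have h0 := (D.equations.mem_iff z hzW).1 hzV
  simp only [h0, zero_smul, Finset.sum_const_zero, add_zero, AlternatingMap.smul_apply,
    smul_eq_mul] at h1
  rw [← wedgeDiff_coordVec he hz
    (fun i => (D.equations.holomorphic i).holomorphicAt D.equations.isOpen hzW)]
  exact h1

/-- In the order along a branch, the index computes the difference between the coefficients of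
the form and the Jacobian minors, for every local presentation. -/
theorem LocalPresentation.IsDecomposition.ord_add_ord [IsManifold 𝓘(ℂ, Fin n → ℂ) ω X] {k : ℕ}
    {Λ : Type*} {Ω : PfaffSystem n k X Λ} {V S : Set X} (hV : IsReducedLCI n k V)
    {b : DivisorBranch n V S} (hb : b.pt ∈ V) {D₀ : LocalPresentation Ω V b.pt}
    {g ξ : X → ℂ} {η : Fin k → FormField n k X} (h : D₀.IsDecomposition g ξ η) {p q : ℕ}
    (hp : b.ord ξ (h.holomorphic_ξ.holomorphicAt D₀.equations.isOpen D₀.mem) = p)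
    (hq : b.ord g (h.holomorphic_g.holomorphicAt D₀.equations.isOpen D₀.mem) = q)
    (D : LocalPresentation Ω V b.pt) (I : Fin k ↪o Fin n) :
    b.ord (D.coeff I) (D.holomorphicAt_coeff I) + q =
      b.ord (D.minor I) (D.holomorphicAt_minor I) + p := by
  have hxe : b.pt ∈ D.e.source := D.subset_source D.mem
  have hxU : b.pt ∈ Ω.U D.α ∩ Ω.U D₀.α := ⟨D.subset_U D.mem, D₀.subset_U D₀.mem⟩
  have hUopen := (Ω.isOpen_U D.α).inter (Ω.isOpen_U D₀.α)
  -- The decomposition is coordinate-free, so the form and equations of `D₀` are read directly in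
  -- the chart of `D`; no change of coordinates is needed.
  have ha : HolomorphicAt n (formCoeff D.e (Ω.form D₀.α) I) b.pt :=
    HolomorphicOn.holomorphicAt (Ω.holomorphic_form D₀.α D.e D.chart_mem I)
      ((Ω.isOpen_U D₀.α).inter D.e.open_source) ⟨hxU.2, hxe⟩
  have hW : IsOpen (D₀.W ∩ D.e.source) := D₀.equations.isOpen.inter D.e.open_source
  have hd : HolomorphicAt n (jacobianMinor D.e D₀.f I) b.pt :=
    (HolomorphicOn.jacobianMinor D.chart_mem hW Set.inter_subset_right
      (fun i => (D₀.equations.holomorphic i).mono Set.inter_subset_left) I).holomorphicAt hW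
      ⟨D₀.mem, hxe⟩
  have hu : HolomorphicAt n (Ω.h D.α D₀.α) b.pt :=
    (Ω.holomorphic_h D.α D₀.α).holomorphicAt hUopen hxU
  have hu' : HolomorphicAt n (Ω.h D₀.α D.α) b.pt :=
    (Ω.holomorphic_h D₀.α D.α).holomorphicAt ((Ω.isOpen_U _).inter (Ω.isOpen_U _)) hxU.symm
  have hcoeff : b.ord (D.coeff I) (D.holomorphicAt_coeff I) = b.ord _ ha := by
    refine b.ord_eq_of_unit hu hu' _ _ ?_ ?_
    · filter_upwards [nhdsWithin_le_nhds (hUopen.mem_nhds hxU)] with z hz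
      -- The two transition functions multiply to `h α α`, which is idempotent and nonzero, hence 1.
      have h1 := Ω.h_cocycle D.α D₀.α D.α z ⟨hz, hz.1⟩
      have h2 := Ω.h_cocycle D.α D.α D.α z ⟨⟨hz.1, hz.1⟩, hz.1⟩
      rw [h1]
      exact mul_left_cancel₀ (Ω.h_ne_zero D.α D.α z ⟨hz.1, hz.1⟩) (by rw [h2, mul_one])
    · filter_upwards [nhdsWithin_le_nhds (hUopen.mem_nhds hxU)] with z hz
      rw [LocalPresentation.coeff, formCoeff, Ω.transition D.α D₀.α z hz]
      rfl
  obtain ⟨c, hc, hfc⟩ := D.equations.exists_transition D₀.equations hb D.mem D₀.mem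
  obtain ⟨c', hc', hfc'⟩ := D₀.equations.exists_transition D.equations hb D₀.mem D.mem
  have hminor : b.ord (D.minor I) (D.holomorphicAt_minor I) = b.ord _ hd := by
    refine b.ord_eq_of_unit (HolomorphicAt.det hc) (HolomorphicAt.det hc') _ _
      (hV.transition_mul_eq_one D.chart_mem D.equations D₀.equations hxe D.mem D₀.mem
        hc hc' hfc hfc') ?_
    filter_upwards [nhdsWithin_le_nhds (hW.mem_nhds ⟨D₀.mem, hxe⟩),
      nhdsWithin_le_nhds (eventually_all.2 fun i => eventually_all.2 fun j => (hc i j).eventually),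
      nhdsWithin_le_nhds (eventually_all.2 fun i => (hfc i).eventually_nhds),
      self_mem_nhdsWithin] with z hz hcz hfz hzV
    exact jacobianMinor_eq_det_mul D.chart_mem hz.2 hcz
      (fun i => (D₀.equations.holomorphic i).holomorphicAt D₀.equations.isOpen hz.1)
      ((D₀.equations.mem_iff z hz.1).1 hzV) hfz I
  rw [hcoeff, hminor]
  refine b.ord_add_ord _ ha _ hd ?_ hp hq
  filter_upwards [nhdsWithin_le_nhds (hW.mem_nhds ⟨D₀.mem, hxe⟩), self_mem_nhdsWithin] with z hz hzV
  exact h.coeff_eq D.chart_mem hz.2 hzV hz.1 I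

end

theorem mainTheorem2 {n k : ℕ} (hk : 1 ≤ k) (hkn : k ≤ n)
    {X : Type*} [TopologicalSpace X] [T2Space X] [SecondCountableTopology X]
    [ChartedSpace (Fin n → ℂ) X] [IsManifold 𝓘(ℂ, Fin n → ℂ) ω X]
    {Λ : Type*} (Ω : PfaffSystem n k X Λ)
    (V : Set X) (hV : IsReducedLCI n k V) (hinv : Ω.IsInvariant V)
    (S : Set X) (hS : IsIrreducibleComponentOf n S (Ω.singularSet ∩ V))
    (b : DivisorBranch n V S) (m : ℤ) (hm : Ω.IsGSVIndex V S b m)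
    (D : LocalPresentation Ω V b.pt) (I : Fin k ↪o Fin n) :
    (b.ord (D.coeff I) (D.holomorphicAt_coeff I) = ⊤ ↔
      b.ord (D.minor I) (D.holomorphicAt_minor I) = ⊤) ∧
    ∀ p q : ℕ, b.ord (D.coeff I) (D.holomorphicAt_coeff I) = p →
      b.ord (D.minor I) (D.holomorphicAt_minor I) = q → m = (p : ℤ) - (q : ℤ) := by
  obtain ⟨D₀, g, ξ, η, h, p₀, q₀, hp₀, hq₀, rfl⟩ := hm
  have key := h.ord_add_ord hV (hS.1.2 b.pt_mem).2 hp₀ hq₀ D I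
  constructor
  -- An infinite order on one side of `key` must come from the other unknown order, since `p₀` and
  -- `q₀` are finite.
  · constructor <;> intro htop <;> rw [htop, top_add] at key
    · exact (WithTop.add_eq_top.1 key.symm).resolve_right (ENat.natCast_ne_top _)
    · exact (WithTop.add_eq_top.1 key).resolve_right (ENat.natCast_ne_top _)
  · intro p q hp hq
    rw [hp, hq] at key
    norm_cast at key
    omega
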